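/- Let $\mathcal H_1,\mathcal H_2$ be real Hilbert spaces, let $C\subset\mathcal H_1$ and $Q\subset\mathcal H_2$ be nonempty closed convex sets, let $A:\mathcal H_1\to\mathcal H_2$ be a bounded linear operator with adjoint $A^*$, and let $S:C\to C$ and $T:Q\to Q$ be nonexpansive, that is, $\|Sx-Sy\|\le\|x-y\|$ on $C$ and $\|Tu-Tv\|\le\|u-v\|$ on $Q$. Write $\rightharpoonup$ for weak convergence. Let $g:Q\times Q\to\mathbb R$ satisfy, for all $u,v,w\in Q$: * $g(u,u)=0$; * $g(u,v)+g(v,u)\le 0$ (monotonicity); * $\limsup_{s\downarrow 0} g(sw+(1-s)u,v)\le g(u,v)$; * $g(u,\cdot)$ is convex and lower semicontinuous on $Q$. Let $f:C\times C\to\mathbb R$ and constants $c_1,c_2>0$ satisfy, for all $x,y,z\in C$: * $f(x,x)=0$; * $f(x,y)\ge 0$ implies $f(y,x)\le 0$ (pseudomonotonicity); * if sequences $(x^k),(y^k)$ in $C$ satisfy $x^k\rightharpoonup x$ and $y^k\rightharpoonup y$, then $f(x^k,y^k)\to f(x,y)$ (joint weak continuity); * $f(x,\cdot)$ is convex and subdifferentiable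 on $C$, the latter meaning that for each $y\in C$ there is $w\in\mathcal H_1$ with $f(x,v)\ge f(x,y)+\langle w,v-y\rangle$ for all $v\in C$; * $f(x,y)+f(y,z)\ge f(x,z)-c_1\|x-y\|^2-c_2\|y-z\|^2$ (Lipschitz-type continuity). Put $\mathrm{Sol}(C,f)=\{x\in C: f(x,y)\ge 0\ \ \forall y\in C\}$, $\mathrm{Sol}(Q,g)=\{u\in Q: g(u,v)\ge 0\ \ \forall v\in Q\}$, $\mathrm{Fix}(S)=\{x\in C: Sx=x\}$, $\mathrm{Fix}(T)=\{u\in Q: Tu=u\}$, and $$\Omega=\{x^*\in \mathrm{Sol}(C,f)\cap\mathrm{Fix}(S):\ Ax^*\in\mathrm{Sol}(Q,g)\cap\mathrm{Fix}(T)\}.$$ For $r>0$ and $v\in\mathcal H_2$, let $T_r^g v$ denote the point $w\in Q$ such that $g(w,q)+\frac1r\langle q-w,w-v\rangle\ge 0$ for all $q\in Q$, and let $P_C$ be the metric projection onto $C$. Let $a,b\in\left(0,\min\left\{\frac1{2c_1},\frac1{2c_2}\right\}\right)$, let $\lambda_k\in[a,b]$ for all $k$, let $0<\alpha<1$, let $0<\mu<\frac1{\|A\|^2}$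 (any $\mu>0$ if $A=0$), and let $\alpha_k>0$ with $\liminf_{k\to\infty}\alpha_k>0$. Starting from a point $x^1\in C$, let the sequences $(x^k),(y^k),(z^k),(t^k),(u^k)$ satisfy, for all $k\ge 1$, $$\begin{aligned} y^k&=\arg\min\left\{\lambda_k f(x^k,y)+\tfrac12\|y-x^k\|^2:\ y\in C\right\},\\ z^k&=\arg\min\left\{\lambda_k f(y^k,y)+\tfrac12\|y-x^k\|^2:\ y\in C\right\},\\ t^k&=(1-\alpha)z^k+\alpha Sz^k,\\ u^k&=T_{\alpha_k}^g At^k,\\ x^{k+1}&=P_C\left(t^k+\mu A^*(Tu^k-At^k)\right). \end{aligned}$$ If $\Omega\ne\emptyset$, then there is $p\in\Omega$ such that $x^k\rightharpoonup p$, $z^k\rightharpoonup p$ and $u^k\rightharpoonup Ap$, where $Ap\in\mathrm{Sol}(Q,g)\cap\mathrm{Fix}(T)$. -/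

import Mathlib

open Filter Topology Set

namespace SEPNM

variable {H : Type*} [NormedAddCommGroup H] [InnerProductSpace ℝ H]

/-- Weak convergence `x k ⇀ p` of a sequence: convergence in the weak topology of `H`. -/
def WeaklyConverges (x : ℕ → H) (p : H) : Prop :=
  Tendsto (fun k => toWeakSpace ℝ H (x k)) atTop (𝓝 (toWeakSpace ℝ H p))

/-- `S` is a nonexpansive self-mapping of `C`. Only the values of `S` on `C` matter. -/
structure IsNonexpansiveOn (C : Set H) (S : H → H) : Prop where
  mapsTo : ∀ x ∈ C, S x ∈ C
  norm_le : ∀ x ∈ C, ∀ y ∈ C, ‖S x - S y‖ ≤ ‖x - y‖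

/-- The fixed point set of `S : C → C`. -/
def Fix (C : Set H) (S : H → H) : Set H :=
  {x | x ∈ C ∧ S x = x}

/-- The solution set `Sol(C, f)` of the equilibrium problem: `x ∈ C` with `f (x, y) ≥ 0` for all
`y ∈ C`. Bifunctions on `C` are functions on `H` of which only the values on `C × C` matter. -/
def Sol (C : Set H) (f : H → H → ℝ) : Set H :=
  {x | x ∈ C ∧ ∀ y ∈ C, 0 ≤ f x y}

/-- `φ` is subdifferentiable on `C`: it has a subgradient, relative to `C`, at each point of `C`. -/
def SubdifferentiableOn (C : Set H) (φ : H → ℝ) : Prop :=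
  ∀ y ∈ C, ∃ w : H, ∀ z ∈ C, φ y + inner ℝ w (z - y) ≤ φ z

/-- The assumptions on the monotone bifunction `g` on `Q`. The upper limit is taken in the extended
reals. -/
structure AssumptionsA (Q : Set H) (g : H → H → ℝ) : Prop where
  diag : ∀ u ∈ Q, g u u = 0
  monotone : ∀ u ∈ Q, ∀ v ∈ Q, g u v + g v u ≤ 0
  limsup_le : ∀ u ∈ Q, ∀ v ∈ Q, ∀ w ∈ Q,
    limsup (fun s : ℝ => ((g (s • w + (1 - s) • u) v : ℝ) : EReal)) (𝓝[>] (0 : ℝ))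
      ≤ ((g u v : ℝ) : EReal)
  convex : ∀ u ∈ Q, ConvexOn ℝ Q (g u)
  lsc : ∀ u ∈ Q, LowerSemicontinuousOn (g u) Q

/-- The assumptions on the pseudomonotone bifunction `f` on `C`, with Lipschitz-type constants
`c₁` and `c₂`. -/
structure AssumptionsB (C : Set H) (f : H → H → ℝ) (c₁ c₂ : ℝ) : Prop where
  diag : ∀ x ∈ C, f x x = 0
  pseudomonotone : ∀ x ∈ C, ∀ y ∈ C, 0 ≤ f x y → f y x ≤ 0
  weaklyContinuous : ∀ x ∈ C, ∀ y ∈ C, ∀ xs ys : ℕ → H, (∀ k, xs k ∈ C) → (∀ k, ys k ∈ C) →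
    WeaklyConverges xs x → WeaklyConverges ys y →
      Tendsto (fun k => f (xs k) (ys k)) atTop (𝓝 (f x y))
  convex : ∀ x ∈ C, ConvexOn ℝ C (f x)
  subdifferentiable : ∀ x ∈ C, SubdifferentiableOn C (f x)
  c₁_pos : 0 < c₁
  c₂_pos : 0 < c₂
  lipschitzType : ∀ x ∈ C, ∀ y ∈ C, ∀ z ∈ C,
    f x z - c₁ * ‖x - y‖ ^ 2 - c₂ * ‖y - z‖ ^ 2 ≤ f x y + f y z

/-- `y = argmin {φ v : v ∈ C}`. -/
def IsArgmin (C : Set H) (φ : H → ℝ) (y : H) : Prop :=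
  y ∈ C ∧ ∀ v ∈ C, φ y ≤ φ v

/-- `p = P_C(x)`: `p` is the metric projection of `x` onto `C`. -/
def IsProjection (C : Set H) (x p : H) : Prop :=
  p ∈ C ∧ ∀ y ∈ C, ‖x - p‖ ≤ ‖x - y‖

/-- The resolvent `T_r^g(u)`, as the set of all `w ∈ Q` such that
`g (w, v) + (1 / r) ⟪v - w, w - u⟫ ≥ 0` for all `v ∈ Q`. -/
def resolvent (Q : Set H) (g : H → H → ℝ) (r : ℝ) (u : H) : Set H :=
  {w | w ∈ Q ∧ ∀ v ∈ Q, 0 ≤ g w v + 1 / r * inner ℝ (v - w) (w - u)}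

variable {H₁ : Type*} [NormedAddCommGroup H₁] [InnerProductSpace ℝ H₁]
  {H₂ : Type*} [NormedAddCommGroup H₂] [InnerProductSpace ℝ H₂]

/-- The solution set `Ω` of the split equilibrium and nonexpansive mapping problem. -/
def solutionSet (C : Set H₁) (Q : Set H₂) (A : H₁ →L[ℝ] H₂) (f : H₁ → H₁ → ℝ) (g : H₂ → H₂ → ℝ)
    (S : H₁ → H₁) (T : H₂ → H₂) : Set H₁ :=
  {x | x ∈ Sol C f ∩ Fix C S ∧ A x ∈ Sol Q g ∩ Fix Q T}

/-- The sequences `x, y, z, t, u` are generated by the extragradient-resolvent scheme with step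
sizes `lam k`, relaxation parameter `α`, resolvent parameters `r k` and parameter `μ`, from a
starting point `x 0 ∈ C`. -/
structure IsGenerated [CompleteSpace H₁] [CompleteSpace H₂] (C : Set H₁) (Q : Set H₂)
    (A : H₁ →L[ℝ] H₂) (f : H₁ → H₁ → ℝ) (g : H₂ → H₂ → ℝ) (S : H₁ → H₁) (T : H₂ → H₂)
    (lam : ℕ → ℝ) (α : ℝ) (r : ℕ → ℝ) (μ : ℝ) (x y z t : ℕ → H₁) (u : ℕ → H₂) : Prop where
  start : x 0 ∈ C
  y_step : ∀ k, IsArgmin C (fun v => lam k * f (x k) v + 1 / 2 * ‖v - x k‖ ^ 2) (y k)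
  z_step : ∀ k, IsArgmin C (fun v => lam k * f (y k) v + 1 / 2 * ‖v - x k‖ ^ 2) (z k)
  t_step : ∀ k, t k = (1 - α) • z k + α • S (z k)
  u_step : ∀ k, u k ∈ resolvent Q g (r k) (A (t k))
  x_step : ∀ k, IsProjection C
    (t k + μ • ContinuousLinearMap.adjoint A (T (u k) - A (t k))) (x (k + 1))

end SEPNM

/-! The scheme is Fejér monotone with respect to the solution set, with a quantified loss. For a
solution `p`, the extragradient, relaxation, resolvent-adjoint and projection steps combine in
`IsGenerated.fejer`: `‖x k - p‖ ^ 2` drops at each iteration by at least a positively weighted sum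
of five squared residuals. Positivity of the weights is exactly `b < 1 / (2 * cᵢ)`, `0 < α < 1` and
`μ * ‖A‖ ^ 2 < 1`.

Hence distances to solutions converge and all residuals vanish, so `x`, `y`, `z`, `t` share their
weak cluster points `p`, with `A p` the corresponding one for `u`. Each such `p` is a solution:
demiclosedness handles `S` and `T`, joint weak continuity handles `f`, and monotonicity with Minty's
lemma handles `g`. Opial's argument leaves a single cluster point. -/

namespace SEPNM

/-! ### Weak convergence, demiclosedness, Opial and Minty arguments. -/

section Weak

variable {H : Type*} [NormedAddCommGroup H] [InnerProductSpace ℝ H]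

theorem weaklyConverges_iff_forall_dual {x : ℕ → H} {p : H} :
    WeaklyConverges x p ↔ ∀ l : StrongDual ℝ H, Tendsto (fun k => l (x k)) atTop (𝓝 (l p)) := by
  have hinj : Function.Injective (topDualPairing ℝ H).flip := by
    intro v w hvw
    refine (SeparatingDual.eq_iff_forall_dual_eq (R := ℝ)).2 fun l => ?_
    exact DFunLike.congr_fun hvw l
  exact WeakBilin.tendsto_iff_forall_eval_tendsto _ hinj

theorem WeaklyConverges.map {H' : Type*} [NormedAddCommGroup H'] [InnerProductSpace ℝ H']
    {x : ℕ → H} {p : H} (h : WeaklyConverges x p) (A : H →L[ℝ] H') :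
    WeaklyConverges (fun k => A (x k)) (A p) :=
  weaklyConverges_iff_forall_dual.2 fun l => weaklyConverges_iff_forall_dual.1 h (l.comp A)

theorem WeaklyConverges.tendsto_inner {x : ℕ → H} {p : H} (h : WeaklyConverges x p) (v : H) :
    Tendsto (fun k => inner ℝ v (x k)) atTop (𝓝 (inner ℝ v p)) :=
  weaklyConverges_iff_forall_dual.1 h (innerSL ℝ v)

theorem weaklyConverges_iff_forall_inner [CompleteSpace H] {x : ℕ → H} {p : H} :
    WeaklyConverges x p ↔ ∀ v : H, Tendsto (fun k => inner ℝ v (x k)) atTop (𝓝 (inner ℝ v p)) := by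
  refine ⟨fun h v => h.tendsto_inner v, fun h => weaklyConverges_iff_forall_dual.2 fun l => ?_⟩
  simpa using h ((InnerProductSpace.toDual ℝ H).symm l)

theorem WeaklyConverges.of_tendsto_norm_sub {x y : ℕ → H} {p : H} (h : WeaklyConverges x p)
    (hxy : Tendsto (fun k => ‖x k - y k‖) atTop (𝓝 0)) : WeaklyConverges y p := by
  refine weaklyConverges_iff_forall_dual.2 fun l => ?_
  have hd : Tendsto (fun k => l (x k - y k)) atTop (𝓝 (l 0)) :=
    (l.continuous.tendsto 0).comp (tendsto_zero_iff_norm_tendsto_zero.2 hxy)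
  simpa using (weaklyConverges_iff_forall_dual.1 h l).sub hd

/-- The variational characterisation of minimisers of `h + ½ ‖· - x‖²`. -/
theorem IsArgmin.inner_le {C : Set H} {h : H → ℝ} {x y : H} (hh : ConvexOn ℝ C h)
    (hy : IsArgmin C (fun v => h v + 1 / 2 * ‖v - x‖ ^ 2) y) {v : H} (hv : v ∈ C) :
    inner ℝ (y - x) (y - v) ≤ h v - h y := by
  obtain ⟨hyC, hmin⟩ := hy
  -- Comparing `y` with `(1 - s) • y + s • v` and dividing by `s` gives the claim up to an error
  -- linear in `s`.
  have key : ∀ s : ℝ, 0 < s → s < 1 →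
      inner ℝ (y - x) (y - v) - s * (1 / 2 * ‖v - y‖ ^ 2) ≤ h v - h y := by
    intro s hs hs1
    have hmem : (1 - s) • y + s • v ∈ C := hh.1 hyC hv (by linarith) hs.le (by ring)
    have hconv : h ((1 - s) • y + s • v) ≤ (1 - s) * h y + s * h v := by
      simpa using hh.2 hyC hv (by linarith) hs.le (by ring : 1 - s + s = 1)
    have hm := hmin _ hmem
    have he : (1 - s) • y + s • v - x = (y - x) - s • (y - v) := by module
    have hn : ‖(1 - s) • y + s • v - x‖ ^ 2
        = ‖y - x‖ ^ 2 - 2 * (s * inner ℝ (y - x) (y - v)) + s ^ 2 * ‖v - y‖ ^ 2 := by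
      rw [he, norm_sub_sq_real, inner_smul_right, norm_smul, mul_pow, norm_sub_rev y v,
        Real.norm_eq_abs, sq_abs]
    simp only [hn] at hm
    refine le_of_mul_le_mul_left ?_ hs
    nlinarith
  have hlim : Tendsto (fun s : ℝ => inner ℝ (y - x) (y - v) - s * (1 / 2 * ‖v - y‖ ^ 2))
      (𝓝[>] 0) (𝓝 (inner ℝ (y - x) (y - v) - 0 * (1 / 2 * ‖v - y‖ ^ 2))) :=
    (Continuous.tendsto (by fun_prop) 0).mono_left nhdsWithin_le_nhds
  have hev : ∀ᶠ s : ℝ in 𝓝[>] 0,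
      inner ℝ (y - x) (y - v) - s * (1 / 2 * ‖v - y‖ ^ 2) ≤ h v - h y := by
    filter_upwards [Ioo_mem_nhdsGT (zero_lt_one (α := ℝ))] with s hs using key s hs.1 hs.2
  simpa using le_of_tendsto hlim hev

theorem IsProjection.inner_le {C : Set H} (hC : Convex ℝ C) {x p : H} (hp : IsProjection C x p)
    {v : H} (hv : v ∈ C) : inner ℝ (p - x) (p - v) ≤ 0 := by
  have h : IsArgmin C (fun v => (fun _ => (0 : ℝ)) v + 1 / 2 * ‖v - x‖ ^ 2) p := by
    refine ⟨hp.1, fun w hw => ?_⟩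
    have := hp.2 w hw
    rw [norm_sub_rev x, norm_sub_rev x] at this
    simp only [zero_add]
    gcongr
  simpa using h.inner_le (convexOn_const 0 hC) hv

theorem IsProjection.norm_sub_le {C : Set H} (hC : Convex ℝ C) {x p : H} (hp : IsProjection C x p)
    {v : H} (hv : v ∈ C) : ‖p - v‖ ^ 2 ≤ ‖x - v‖ ^ 2 := by
  have h := hp.inner_le hC hv
  have he : x - v = (p - v) - (p - x) := by abel
  rw [he, norm_sub_sq_real (p - v), real_inner_comm]
  nlinarith [sq_nonneg ‖p - x‖]

/-- A closed convex set is weakly sequentially closed. -/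
theorem WeaklyConverges.mem_of_convex {C : Set H} (hCc : IsClosed C)
    (hC : Convex ℝ C) {x : ℕ → H} {p : H} (h : WeaklyConverges x p) (hx : ∀ᶠ k in atTop, x k ∈ C) :
    p ∈ C := by
  have h₁ : toWeakSpace ℝ H p ∈ closure (toWeakSpace ℝ H '' C) :=
    mem_closure_of_tendsto h (hx.mono fun k hk => mem_image_of_mem _ hk)
  rw [← hC.toWeakSpace_closure ℝ, hCc.closure_eq] at h₁
  obtain ⟨q, hq, hqp⟩ := h₁
  rwa [← (toWeakSpace ℝ H).injective hqp]

/-- Bounded sequences in a Hilbert space have weakly convergent subsequences. -/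
theorem exists_weaklyConverges_subseq [CompleteSpace H] {x : ℕ → H} {M : ℝ}
    (hx : ∀ k, ‖x k‖ ≤ M) :
    ∃ p : H, ∃ φ : ℕ → ℕ, StrictMono φ ∧ WeaklyConverges (x ∘ φ) p := by
  -- The closed span of the sequence is separable, so sequential Banach–Alaoglu applies there;
  -- testing against `v` amounts to testing against its projection onto `K`.
  let K : Submodule ℝ H := (Submodule.span ℝ (range x)).topologicalClosure
  have hsep : TopologicalSpace.IsSeparable (K : Set H) := by
    rw [Submodule.topologicalClosure_coe]
    exact ((countable_range x).isSeparable.span (R := ℝ)).closure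
  have : TopologicalSpace.SeparableSpace K := hsep.separableSpace
  have hKc : IsClosed (K : Set H) := Submodule.isClosed_topologicalClosure _
  have : CompleteSpace K := hKc.completeSpace_coe
  have hxK : ∀ k, x k ∈ K := fun k =>
    Submodule.le_topologicalClosure _ (Submodule.subset_span (mem_range_self k))
  let ξ : ℕ → WeakDual ℝ K := fun k =>
    StrongDual.toWeakDual (InnerProductSpace.toDual ℝ K ⟨x k, hxK k⟩)
  have hmem : ∀ k, ξ k ∈ WeakDual.toStrongDual ⁻¹' Metric.closedBall (0 : StrongDual ℝ K) M := by
    intro k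
    have : ‖InnerProductSpace.toDual ℝ K ⟨x k, hxK k⟩‖ ≤ M := by
      rw [LinearIsometryEquiv.norm_map]; exact hx k
    exact mem_closedBall_zero_iff.2 this
  obtain ⟨η, -, φ, hφ, hlim⟩ := WeakDual.isSeqCompact_closedBall ℝ K 0 M hmem
  let q : K := (InnerProductSpace.toDual ℝ K).symm (WeakDual.toStrongDual η)
  refine ⟨q, φ, hφ, weaklyConverges_iff_forall_inner.2 fun v => ?_⟩
  have h₁ : Tendsto (fun k => ξ (φ k) (K.orthogonalProjectionOnto v)) atTop
      (𝓝 (η (K.orthogonalProjectionOnto v))) :=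
    ((WeakDual.eval_continuous (K.orthogonalProjectionOnto v)).tendsto η).comp hlim
  have h₂ : ∀ w : K, inner ℝ w (K.orthogonalProjectionOnto v) = inner ℝ v (w : H) := by
    intro w
    rw [real_inner_comm, Submodule.inner_orthogonalProjectionOnto_eq_of_mem_right]
  have h₃ : η (K.orthogonalProjectionOnto v) = inner ℝ v (q : H) := by
    rw [← h₂ q, ← InnerProductSpace.toDual_apply_apply (𝕜 := ℝ), LinearIsometryEquiv.apply_symm_apply]
    rfl
  rw [← h₃]
  refine h₁.congr fun k => ?_
  exact h₂ ⟨x (φ k), hxK (φ k)⟩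

/-- Demiclosedness principle: if `xₖ ⇀ p` and `xₖ - S xₖ → 0` then `p` is a fixed point of the
nonexpansive map `S`. -/
theorem IsNonexpansiveOn.mem_fix_of_weaklyConverges {C : Set H} {S : H → H}
    (hS : IsNonexpansiveOn C S) (hCc : IsClosed C) (hC : Convex ℝ C) {x : ℕ → H} {p : H}
    (hx : ∀ k, x k ∈ C) {M : ℝ} (hM : ∀ k, ‖x k‖ ≤ M) (h : WeaklyConverges x p)
    (hfix : Tendsto (fun k => ‖x k - S (x k)‖) atTop (𝓝 0)) : p ∈ Fix C S := by
  have hp : p ∈ C := h.mem_of_convex hCc hC (.of_forall hx)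
  refine ⟨hp, ?_⟩
  -- Expand `‖x k - S p‖ ^ 2` around `p` and compare with the square of the nonexpansive bound: `‖x
  -- k - p‖ ^ 2` cancels, and what remains on the right tends to `0`.
  have key : ∀ k, ‖p - S p‖ ^ 2 ≤ ‖x k - S (x k)‖ ^ 2 + 2 * ‖x k - S (x k)‖ * (M + ‖p‖)
      - 2 * (inner ℝ (p - S p) (x k) - inner ℝ (p - S p) p) := by
    intro k
    have h₁ : ‖x k - S p‖ ≤ ‖x k - S (x k)‖ + ‖x k - p‖ :=
      (norm_sub_le_norm_sub_add_norm_sub _ (S (x k)) _).trans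
        (by gcongr; exact hS.norm_le _ (hx k) _ hp)
    have h₂ : ‖x k - p‖ ≤ M + ‖p‖ := (norm_sub_le _ _).trans (by gcongr; exact hM k)
    have h₃ : ‖x k - S p‖ ^ 2 = ‖x k - p‖ ^ 2
        + 2 * (inner ℝ (p - S p) (x k) - inner ℝ (p - S p) p) + ‖p - S p‖ ^ 2 := by
      rw [← inner_sub_right, real_inner_comm, ← norm_add_sq_real, sub_add_sub_cancel]
    have h₄ : ‖x k - S p‖ ^ 2 ≤ (‖x k - S (x k)‖ + ‖x k - p‖) ^ 2 := by gcongr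
    nlinarith [mul_le_mul_of_nonneg_left h₂ (norm_nonneg (x k - S (x k)))]
  have hlim := ((hfix.pow 2).add ((hfix.const_mul 2).mul_const (M + ‖p‖))).sub
    (((h.tendsto_inner (p - S p)).sub_const (inner ℝ (p - S p) p)).const_mul 2)
  have := ge_of_tendsto' hlim key
  have h0 : ‖p - S p‖ ^ 2 ≤ 0 := by simpa using this
  have : ‖p - S p‖ = 0 := by nlinarith [norm_nonneg (p - S p)]
  exact (sub_eq_zero.1 (norm_eq_zero.1 this)).symm

/-- Opial's argument: if the distances to two weak cluster points converge, the cluster points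
agree. -/
theorem eq_of_weaklyConverges_subseq {x : ℕ → H} {p q : H} {φ ψ : ℕ → ℕ}
    (hφ : Tendsto φ atTop atTop) (hψ : Tendsto ψ atTop atTop)
    (hp : WeaklyConverges (x ∘ φ) p) (hq : WeaklyConverges (x ∘ ψ) q) {a b : ℝ}
    (ha : Tendsto (fun k => ‖x k - p‖ ^ 2) atTop (𝓝 a))
    (hb : Tendsto (fun k => ‖x k - q‖ ^ 2) atTop (𝓝 b)) : p = q := by
  -- The terms `‖x k‖ ^ 2` cancel, so this inner product converges along the whole sequence; its
  -- limit is computed along both subsequences.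
  have hid : ∀ k, inner ℝ (p - q) (x k)
      = (‖x k - q‖ ^ 2 - ‖x k - p‖ ^ 2 + (‖p‖ ^ 2 - ‖q‖ ^ 2)) / 2 := by
    intro k
    rw [norm_sub_sq_real, norm_sub_sq_real, inner_sub_left, real_inner_comm p, real_inner_comm q]
    ring
  have hlim := (((hb.sub ha).add_const (‖p‖ ^ 2 - ‖q‖ ^ 2)).div_const 2).congr fun k => (hid k).symm
  have h₁ := tendsto_nhds_unique (hlim.comp hφ) (hp.tendsto_inner (p - q))
  have h₂ := tendsto_nhds_unique (hlim.comp hψ) (hq.tendsto_inner (p - q))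
  have h₃ : inner ℝ (p - q) (p - q) = 0 := by rw [inner_sub_right, ← h₁, ← h₂, sub_self]
  exact sub_eq_zero.1 (inner_self_eq_zero.1 h₃)

/-- Minty's lemma for monotone bifunctions. -/
theorem AssumptionsA.mem_sol_of_forall_le {Q : Set H} {g : H → H → ℝ} (hg : AssumptionsA Q g)
    {p : H} (hp : p ∈ Q) (h : ∀ v ∈ Q, g v p ≤ 0) : p ∈ Sol Q g := by
  refine ⟨hp, fun v hv => ?_⟩
  have hQ := (hg.convex p hp).1
  -- With `m = s • v + (1 - s) • p`, convexity gives `0 = g m m ≤ s * g m v + (1 - s) * g m p`,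
  -- whose last term is nonpositive.
  have hs : ∀ s ∈ Ioo (0 : ℝ) 1, 0 ≤ g (s • v + (1 - s) • p) v := by
    intro s hs
    have hm : s • v + (1 - s) • p ∈ Q := hQ hv hp hs.1.le (by linarith [hs.2]) (by ring)
    have hc := (hg.convex _ hm).2 hv hp hs.1.le (by linarith [hs.2]) (by ring : s + (1 - s) = 1)
    rw [hg.diag _ hm, smul_eq_mul, smul_eq_mul] at hc
    have := mul_nonpos_of_nonneg_of_nonpos (by linarith [hs.2] : 0 ≤ 1 - s) (h _ hm)
    exact nonneg_of_mul_nonneg_right (by linarith) hs.1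
  have hl : (0 : EReal) ≤ limsup (fun s : ℝ => ((g (s • v + (1 - s) • p) v : ℝ) : EReal))
      (𝓝[>] (0 : ℝ)) := by
    refine le_limsup_of_frequently_le (Eventually.frequently ?_)
    filter_upwards [Ioo_mem_nhdsGT (zero_lt_one (α := ℝ))] with s hs'
    exact_mod_cast hs s hs'
  exact_mod_cast hl.trans (hg.limsup_le p hp v hv v hv)

/-- Convex lower semicontinuous functions are weakly sequentially lower semicontinuous. -/
theorem WeaklyConverges.le_of_tendsto {Q : Set H} {h : H → ℝ}
    (hQc : IsClosed Q) (hh : ConvexOn ℝ Q h) (hl : LowerSemicontinuousOn h Q) {x : ℕ → H} {p : H}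
    (hx : ∀ k, x k ∈ Q) (hp : WeaklyConverges x p) {c : ℕ → ℝ} {l : ℝ}
    (hc : Tendsto c atTop (𝓝 l)) (hle : ∀ᶠ k in atTop, h (x k) ≤ c k) : h p ≤ l := by
  refine le_of_forall_gt_imp_ge_of_dense fun e he => ?_
  have hclosed : IsClosed {v ∈ Q | h v ≤ e} := by
    obtain ⟨v, hv, hv'⟩ := lowerSemicontinuousOn_iff_preimage_Iic.1 hl e
    have : {v ∈ Q | h v ≤ e} = Q ∩ v := hv'
    rw [this]
    exact hQc.inter hv
  refine (hp.mem_of_convex hclosed (hh.convex_le e) ?_).2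
  filter_upwards [hle, hc.eventually_lt_const he] with k h₁ h₂ using ⟨hx k, h₁.trans h₂.le⟩

end Weak

end SEPNM

namespace SEPNM

/-! ### One-step estimates for each operation of the scheme. -/

section Estimates

variable {H : Type*} [NormedAddCommGroup H] [InnerProductSpace ℝ H]

/-- The basic estimate for one step of the extragradient method. -/
theorem AssumptionsB.extragradient_le {C : Set H} {f : H → H → ℝ} {c₁ c₂ : ℝ}
    (hf : AssumptionsB C f c₁ c₂) {l : ℝ} (hl : 0 < l) {x y z p : H} (hx : x ∈ C)
    (hy : IsArgmin C (fun v => l * f x v + 1 / 2 * ‖v - x‖ ^ 2) y)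
    (hz : IsArgmin C (fun v => l * f y v + 1 / 2 * ‖v - x‖ ^ 2) z) (hp : p ∈ Sol C f) :
    ‖z - p‖ ^ 2 ≤ ‖x - p‖ ^ 2 - (1 - 2 * l * c₁) * ‖x - y‖ ^ 2
      - (1 - 2 * l * c₂) * ‖y - z‖ ^ 2 := by
  -- Optimality of `y` is tested at `z`, that of `z` at `p`; the Lipschitz-type condition links the
  -- two, and pseudomonotonicity discards `f y p`.
  have h₁ := hy.inner_le (h := fun v => l * f x v) ((hf.convex x hx).smul hl.le) hz.1
  have h₂ := hz.inner_le (h := fun v => l * f y v) ((hf.convex y hy.1).smul hl.le) hp.1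
  have h₃ := mul_le_mul_of_nonneg_left (hf.lipschitzType x hx y hy.1 z hz.1) hl.le
  have h₄ := mul_nonpos_of_nonneg_of_nonpos hl.le
    (hf.pseudomonotone p hp.1 y hy.1 (hp.2 y hy.1))
  have e₁ : ‖z - x‖ ^ 2 = ‖y - x‖ ^ 2 - 2 * inner ℝ (y - x) (y - z) + ‖y - z‖ ^ 2 := by
    rw [← norm_sub_sq_real]; congr 2; abel
  have e₂ : ‖x - p‖ ^ 2 = ‖z - p‖ ^ 2 - 2 * inner ℝ (z - x) (z - p) + ‖z - x‖ ^ 2 := by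
    rw [real_inner_comm, ← norm_sub_sq_real]; congr 2; abel
  rw [norm_sub_rev x y]
  rw [norm_sub_rev x y] at h₃
  nlinarith

/-- The loss term comes from the identity for the squared norm of a convex combination of `z - p`
and `S z - p`. -/
theorem IsNonexpansiveOn.relaxed_le {C : Set H} {S : H → H} (hS : IsNonexpansiveOn C S) {α : ℝ}
    (hα : α ∈ Ioo (0 : ℝ) 1) {z p : H} (hz : z ∈ C) (hp : p ∈ Fix C S) :
    ‖(1 - α) • z + α • S z - p‖ ^ 2 ≤ ‖z - p‖ ^ 2 - α * (1 - α) * ‖z - S z‖ ^ 2 := by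
  have h := hS.norm_le z hz p hp.1
  rw [hp.2] at h
  have h' : ‖S z - p‖ ^ 2 ≤ ‖z - p‖ ^ 2 := by gcongr
  have e₁ : (1 - α) • z + α • S z - p = (z - p) - α • (z - S z) := by module
  have e₂ : ‖S z - p‖ ^ 2 = ‖z - p‖ ^ 2 - 2 * inner ℝ (z - p) (z - S z) + ‖z - S z‖ ^ 2 := by
    rw [← norm_sub_sq_real]; congr 2; abel
  rw [e₁, norm_sub_sq_real, inner_smul_right, norm_smul, mul_pow, Real.norm_eq_abs, sq_abs]
  nlinarith [hα.1]

/-- Monotonicity and `0 ≤ g p w` force `g w p ≤ 0`, so the resolvent inequality at `p` makes `inner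
ℝ (p - w) (w - v)` nonnegative. -/
theorem AssumptionsA.resolvent_le {Q : Set H} {g : H → H → ℝ} (hg : AssumptionsA Q g) {r : ℝ}
    (hr : 0 < r) {v w p : H} (hw : w ∈ resolvent Q g r v) (hp : p ∈ Sol Q g) :
    ‖w - p‖ ^ 2 ≤ ‖v - p‖ ^ 2 - ‖w - v‖ ^ 2 := by
  have h₁ := hw.2 p hp.1
  have h₂ := hg.monotone w hw.1 p hp.1
  have h₃ := hp.2 w hw.1
  have h₄ : 0 ≤ inner ℝ (p - w) (w - v) :=
    nonneg_of_mul_nonneg_right (by linarith : 0 ≤ 1 / r * inner ℝ (p - w) (w - v)) (by positivity)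
  have e : ‖v - p‖ ^ 2 = ‖p - w‖ ^ 2 + 2 * inner ℝ (p - w) (w - v) + ‖w - v‖ ^ 2 := by
    rw [← norm_add_sq_real, norm_sub_rev]; congr 2; abel
  rw [norm_sub_rev w p]
  linarith

/-- Monotonicity moves `w` into the second argument, where convexity and lower semicontinuity let
the bound pass to weak limits. -/
theorem AssumptionsA.apply_le_of_mem_resolvent {Q : Set H} {g : H → H → ℝ}
    (hg : AssumptionsA Q g) {r : ℝ} (hr : 0 < r) {v w q : H} (hw : w ∈ resolvent Q g r v)
    (hq : q ∈ Q) : g q w ≤ 1 / r * (‖q - w‖ * ‖w - v‖) := by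
  have h₁ := hw.2 q hq
  have h₂ := hg.monotone w hw.1 q hq
  have h₃ : 1 / r * inner ℝ (q - w) (w - v) ≤ 1 / r * (‖q - w‖ * ‖w - v‖) := by
    gcongr
    exact real_inner_le_norm _ _
  linarith

variable {H' : Type*} [NormedAddCommGroup H'] [InnerProductSpace ℝ H'] [CompleteSpace H]
  [CompleteSpace H']

/-- The adjoint turns the cross term into `2 * μ * inner ℝ (A t - A p) (T u - A t)`, which
polarisation and `hup` bound by `-μ * (‖u - A t‖ ^ 2 + ‖T u - A t‖ ^ 2)`; the quadratic term costs
at most `μ ^ 2 * ‖A‖ ^ 2 * ‖T u - A t‖ ^ 2`. -/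
theorem IsNonexpansiveOn.adjoint_step_le {Q : Set H'} {T : H' → H'} (hT : IsNonexpansiveOn Q T)
    (A : H →L[ℝ] H') {μ : ℝ} (hμ : 0 < μ) {t p : H} {u : H'} (hu : u ∈ Q)
    (hp : A p ∈ Fix Q T) (hup : ‖u - A p‖ ^ 2 ≤ ‖A t - A p‖ ^ 2 - ‖u - A t‖ ^ 2) :
    ‖t + μ • ContinuousLinearMap.adjoint A (T u - A t) - p‖ ^ 2
      ≤ ‖t - p‖ ^ 2 - μ * ‖u - A t‖ ^ 2 - μ * (1 - μ * ‖A‖ ^ 2) * ‖T u - A t‖ ^ 2 := by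
  have h := hT.norm_le u hu _ hp.1
  rw [hp.2] at h
  have h' : ‖T u - A p‖ ^ 2 ≤ ‖u - A p‖ ^ 2 := by gcongr
  have hadj : ‖ContinuousLinearMap.adjoint A (T u - A t)‖ ≤ ‖A‖ * ‖T u - A t‖ := by
    simpa using (ContinuousLinearMap.adjoint A).le_opNorm (T u - A t)
  have hadj' : ‖ContinuousLinearMap.adjoint A (T u - A t)‖ ^ 2 ≤ ‖A‖ ^ 2 * ‖T u - A t‖ ^ 2 := by
    rw [← mul_pow]; gcongr
  have e₁ : t + μ • ContinuousLinearMap.adjoint A (T u - A t) - p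
      = (t - p) + μ • ContinuousLinearMap.adjoint A (T u - A t) := by abel
  have e₂ : ‖T u - A p‖ ^ 2
      = ‖A t - A p‖ ^ 2 + 2 * inner ℝ (A t - A p) (T u - A t) + ‖T u - A t‖ ^ 2 := by
    rw [← norm_add_sq_real]; congr 2; abel
  rw [e₁, norm_add_sq_real, inner_smul_right, norm_smul, mul_pow, Real.norm_eq_abs, sq_abs,
    ContinuousLinearMap.adjoint_inner_right, map_sub]
  nlinarith [mul_le_mul_of_nonneg_left hadj' (sq_nonneg μ),
    mul_le_mul_of_nonneg_left (h'.trans hup) hμ.le]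

end Estimates

/-- If `c * eₖ² ≤ dₖ - dₖ₊₁` with `c > 0` and `d` convergent, then `eₖ → 0`. -/
theorem tendsto_zero_of_mul_sq_le_sub {d e : ℕ → ℝ} {L c : ℝ} (hd : Tendsto d atTop (𝓝 L))
    (hc : 0 < c) (he : ∀ k, 0 ≤ e k) (h : ∀ k, c * e k ^ 2 ≤ d k - d (k + 1)) :
    Tendsto e atTop (𝓝 0) := by
  have h₁ : Tendsto (fun k => (d k - d (k + 1)) / c) atTop (𝓝 0) := by
    simpa using (hd.sub (hd.comp (tendsto_add_atTop_nat 1))).div_const c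
  have h₂ : Tendsto (fun k => e k ^ 2) atTop (𝓝 0) :=
    squeeze_zero (fun k => sq_nonneg _) (fun k => by rw [le_div_iff₀ hc, mul_comm]; exact h k) h₁
  have h₃ := (Real.continuous_sqrt.tendsto 0).comp h₂
  rw [Real.sqrt_zero] at h₃
  exact h₃.congr fun k => Real.sqrt_sq (he k)

theorem exists_norm_le_of_tendsto_norm_sub {E : Type*} [SeminormedAddCommGroup E] {x y : ℕ → E}
    {M : ℝ} (hx : ∀ k, ‖x k‖ ≤ M) (hxy : Tendsto (fun k => ‖x k - y k‖) atTop (𝓝 0)) :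
    ∃ M', ∀ k, ‖y k‖ ≤ M' := by
  obtain ⟨B, hB⟩ := hxy.bddAbove_range
  refine ⟨M + B, fun k => ?_⟩
  have h₁ : ‖x k - y k‖ ≤ B := hB (mem_range_self k)
  linarith [hx k, norm_le_norm_add_norm_sub (x k) (y k)]

end SEPNM

namespace SEPNM

/-! ### Fejér monotonicity and identification of weak cluster points. -/

section Scheme

variable {H₁ : Type*} [NormedAddCommGroup H₁] [InnerProductSpace ℝ H₁] [CompleteSpace H₁]
  {H₂ : Type*} [NormedAddCommGroup H₂] [InnerProductSpace ℝ H₂] [CompleteSpace H₂]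
  {C : Set H₁} {Q : Set H₂} {A : H₁ →L[ℝ] H₂} {f : H₁ → H₁ → ℝ} {g : H₂ → H₂ → ℝ}
  {S : H₁ → H₁} {T : H₂ → H₂} {c₁ c₂ a b α μ : ℝ} {lam r : ℕ → ℝ}
  {x y z t : ℕ → H₁} {u : ℕ → H₂}

theorem IsGenerated.mem (hgen : IsGenerated C Q A f g S T lam α r μ x y z t u) (k : ℕ) :
    x k ∈ C := by
  cases k with
  | zero => exact hgen.start
  | succ k => exact (hgen.x_step k).1

/-- The quantitative Fejér monotonicity of the scheme with respect to the solution set. -/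
theorem IsGenerated.fejer (hgen : IsGenerated C Q A f g S T lam α r μ x y z t u)
    (hC : Convex ℝ C) (hS : IsNonexpansiveOn C S) (hT : IsNonexpansiveOn Q T)
    (hg : AssumptionsA Q g) (hf : AssumptionsB C f c₁ c₂)
    (ha : 0 < a) (hlam : ∀ k, lam k ∈ Icc a b) (hα : α ∈ Ioo (0 : ℝ) 1)
    (hμ : 0 < μ) (hr : ∀ k, 0 < r k) {p : H₁} (hp : p ∈ solutionSet C Q A f g S T) (k : ℕ) :
    (1 - 2 * b * c₁) * ‖x k - y k‖ ^ 2 + (1 - 2 * b * c₂) * ‖y k - z k‖ ^ 2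
      + α * (1 - α) * ‖z k - S (z k)‖ ^ 2 + μ * ‖u k - A (t k)‖ ^ 2
      + μ * (1 - μ * ‖A‖ ^ 2) * ‖T (u k) - A (t k)‖ ^ 2
      ≤ ‖x k - p‖ ^ 2 - ‖x (k + 1) - p‖ ^ 2 := by
  obtain ⟨⟨hpf, hpS⟩, hpg, hpT⟩ := hp
  have h₁ := hf.extragradient_le (ha.trans_le (hlam k).1) (hgen.mem k) (hgen.y_step k)
    (hgen.z_step k) hpf
  have h₂ := hS.relaxed_le hα (hgen.z_step k).1 hpS
  rw [← hgen.t_step k] at h₂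
  have h₃ := hg.resolvent_le (hr k) (hgen.u_step k) hpg
  have h₄ := hT.adjoint_step_le A hμ (hgen.u_step k).1 hpT h₃
  have h₅ := (hgen.x_step k).norm_sub_le hC hpf.1
  have h₆ : (1 - 2 * b * c₁) * ‖x k - y k‖ ^ 2 ≤ (1 - 2 * lam k * c₁) * ‖x k - y k‖ ^ 2 := by
    have := hf.c₁_pos.le
    gcongr
    exact (hlam k).2
  have h₇ : (1 - 2 * b * c₂) * ‖y k - z k‖ ^ 2 ≤ (1 - 2 * lam k * c₂) * ‖y k - z k‖ ^ 2 := by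
    have := hf.c₂_pos.le
    gcongr
    exact (hlam k).2
  linarith

/-- If `x_φ ⇀ p` and `yₖ - xₖ → 0`, then `p` solves the equilibrium problem for `f`. -/
theorem IsGenerated.mem_sol (hgen : IsGenerated C Q A f g S T lam α r μ x y z t u)
    (hf : AssumptionsB C f c₁ c₂) (ha : 0 < a) (hlam : ∀ k, a ≤ lam k) {φ : ℕ → ℕ} {p : H₁}
    (hp : p ∈ C) (hxp : WeaklyConverges (x ∘ φ) p) (hyp : WeaklyConverges (y ∘ φ) p)
    {M : ℝ} (hM : ∀ k, ‖y k‖ ≤ M)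
    (hxy : Tendsto (fun k => ‖x (φ k) - y (φ k)‖) atTop (𝓝 0)) : p ∈ Sol C f := by
  refine ⟨hp, fun v hv => ?_⟩
  -- Optimality of `y` tested at `v` bounds this difference below by a multiple of `‖x - y‖`,
  -- uniformly because the step sizes stay above `a`.
  have hlim : Tendsto (fun k => f (x (φ k)) v - f (x (φ k)) (y (φ k))) atTop
      (𝓝 (f p v - f p p)) :=
    (hf.weaklyContinuous p hp v hv (x ∘ φ) (fun _ => v) (fun k => hgen.mem _) (fun _ => hv) hxp
      tendsto_const_nhds).sub
    (hf.weaklyContinuous p hp p hp (x ∘ φ) (y ∘ φ) (fun k => hgen.mem _)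
      (fun k => (hgen.y_step _).1) hxp hyp)
  have hlow : Tendsto (fun k => -(‖x (φ k) - y (φ k)‖ * (M + ‖v‖) / a)) atTop (𝓝 0) := by
    simpa using ((hxy.mul_const (M + ‖v‖)).div_const a).neg
  have := le_of_tendsto_of_tendsto' hlow hlim fun k => ?_
  · rwa [hf.diag p hp, sub_zero] at this
  · set j := φ k
    have hl : 0 < lam j := ha.trans_le (hlam j)
    have h₁ := (hgen.y_step j).inner_le (h := fun v => lam j * f (x j) v)
      ((hf.convex _ (hgen.mem j)).smul hl.le) hv
    have h₂ : -(‖x j - y j‖ * (M + ‖v‖)) ≤ inner ℝ (y j - x j) (y j - v) := by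
      have h₃ := neg_le_of_abs_le (abs_real_inner_le_norm (y j - x j) (y j - v))
      have h₄ : ‖y j - v‖ ≤ M + ‖v‖ := (norm_sub_le _ _).trans (by gcongr; exact hM j)
      rw [norm_sub_rev (x j)]
      nlinarith [mul_le_mul_of_nonneg_left h₄ (norm_nonneg (y j - x j))]
    have h₅ : ‖x j - y j‖ * (M + ‖v‖) / lam j ≤ ‖x j - y j‖ * (M + ‖v‖) / a := by
      have : 0 ≤ M + ‖v‖ := add_nonneg ((norm_nonneg _).trans (hM j)) (norm_nonneg v)
      gcongr
      exact hlam j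
    have h₆ : -(‖x j - y j‖ * (M + ‖v‖) / lam j) ≤ f (x j) v - f (x j) (y j) := by
      rw [← neg_div, div_le_iff₀ hl]
      linarith
    linarith

/-- If `u_φ ⇀ q` and `uₖ - A tₖ → 0`, then `q` solves the equilibrium problem for `g`. -/
theorem IsGenerated.mem_sol_image (hgen : IsGenerated C Q A f g S T lam α r μ x y z t u)
    (hQc : IsClosed Q) (hQ : Convex ℝ Q) (hg : AssumptionsA Q g) {δ : ℝ} (hδ : 0 < δ)
    {φ : ℕ → ℕ} (hr : ∀ᶠ k in atTop, δ < r (φ k)) {q : H₂} (huq : WeaklyConverges (u ∘ φ) q)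
    {M : ℝ} (hM : ∀ k, ‖u k‖ ≤ M)
    (hu : Tendsto (fun k => ‖u (φ k) - A (t (φ k))‖) atTop (𝓝 0)) : q ∈ Sol Q g := by
  have huQ : ∀ k, (u ∘ φ) k ∈ Q := fun k => (hgen.u_step _).1
  refine hg.mem_sol_of_forall_le (huq.mem_of_convex hQc hQ (.of_forall huQ)) fun v hv => ?_
  have hlim : Tendsto (fun k => 1 / δ * ((‖v‖ + M) * ‖u (φ k) - A (t (φ k))‖)) atTop (𝓝 0) := by
    simpa using (hu.const_mul (‖v‖ + M)).const_mul (1 / δ)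
  refine huq.le_of_tendsto hQc (hg.convex v hv) (hg.lsc v hv) huQ hlim ?_
  filter_upwards [hr] with k hk
  refine (hg.apply_le_of_mem_resolvent (hδ.trans hk) (hgen.u_step _) hv).trans ?_
  have : ‖v - u (φ k)‖ ≤ ‖v‖ + M := (norm_sub_le _ _).trans (by gcongr; exact hM _)
  gcongr

end Scheme

end SEPNM

/-! ### The convergence theorem. -/

theorem theorem3p1
    {H₁ : Type*} [NormedAddCommGroup H₁] [InnerProductSpace ℝ H₁] [CompleteSpace H₁]
    {H₂ : Type*} [NormedAddCommGroup H₂] [InnerProductSpace ℝ H₂] [CompleteSpace H₂]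
    (C : Set H₁) (hC_nonempty : C.Nonempty) (hC_closed : IsClosed C) (hC_convex : Convex ℝ C)
    (Q : Set H₂) (hQ_nonempty : Q.Nonempty) (hQ_closed : IsClosed Q) (hQ_convex : Convex ℝ Q)
    (S : H₁ → H₁) (hS : SEPNM.IsNonexpansiveOn C S)
    (T : H₂ → H₂) (hT : SEPNM.IsNonexpansiveOn Q T)
    (g : H₂ → H₂ → ℝ) (hg : SEPNM.AssumptionsA Q g)
    (f : H₁ → H₁ → ℝ) (c₁ c₂ : ℝ) (hf : SEPNM.AssumptionsB C f c₁ c₂)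
    (A : H₁ →L[ℝ] H₂)
    (a b : ℝ) (ha : a ∈ Set.Ioo 0 (min (1 / (2 * c₁)) (1 / (2 * c₂))))
    (hb : b ∈ Set.Ioo 0 (min (1 / (2 * c₁)) (1 / (2 * c₂))))
    (lam : ℕ → ℝ) (hlam : ∀ k, lam k ∈ Set.Icc a b)
    (α : ℝ) (hα : α ∈ Set.Ioo (0 : ℝ) 1)
    -- `μ < 1 / ‖A‖ ^ 2`, where the right-hand side is `+∞` if `A = 0`
    (μ : ℝ) (hμ_pos : 0 < μ) (hμ_lt : μ * ‖A‖ ^ 2 < 1)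
    (r : ℕ → ℝ) (hr_pos : ∀ k, 0 < r k)
    (hr_liminf : 0 < Filter.liminf (fun k => ((r k : ℝ) : EReal)) Filter.atTop)
    (x y z t : ℕ → H₁) (u : ℕ → H₂)
    (hgen : SEPNM.IsGenerated C Q A f g S T lam α r μ x y z t u)
    (hΩ : (SEPNM.solutionSet C Q A f g S T).Nonempty) :
    ∃ p ∈ SEPNM.solutionSet C Q A f g S T,
      SEPNM.WeaklyConverges x p ∧ SEPNM.WeaklyConverges z p ∧
      SEPNM.WeaklyConverges u (A p) ∧ A p ∈ SEPNM.Sol Q g ∩ SEPNM.Fix Q T := by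
  have hc₁ : 0 < 1 - 2 * b * c₁ := by
    have := (lt_div_iff₀ (by linarith [hf.c₁_pos])).1 (hb.2.trans_le (min_le_left _ _))
    linarith
  have hc₂ : 0 < 1 - 2 * b * c₂ := by
    have := (lt_div_iff₀ (by linarith [hf.c₂_pos])).1 (hb.2.trans_le (min_le_right _ _))
    linarith
  have hc₃ : 0 < α * (1 - α) := mul_pos hα.1 (sub_pos.2 hα.2)
  have hc₄ : 0 < μ * (1 - μ * ‖A‖ ^ 2) := mul_pos hμ_pos (sub_pos.2 hμ_lt)
  have hfejer := fun {p : H₁} (hp : p ∈ SEPNM.solutionSet C Q A f g S T) =>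
    hgen.fejer hC_convex hS hT hg hf ha.1 hlam hα hμ_pos hr_pos hp
  have hanti : ∀ p ∈ SEPNM.solutionSet C Q A f g S T, Antitone fun k => ‖x k - p‖ ^ 2 := by
    intro p hp
    refine antitone_nat_of_succ_le fun k => ?_
    have := hfejer hp k
    have : 0 ≤ ‖x k - p‖ ^ 2 - ‖x (k + 1) - p‖ ^ 2 := le_trans (by positivity) this
    linarith
  have hdist : ∀ p ∈ SEPNM.solutionSet C Q A f g S T,
      ∃ L, Tendsto (fun k => ‖x k - p‖ ^ 2) atTop (𝓝 L) := fun p hp =>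
    ⟨_, tendsto_atTop_ciInf (hanti p hp) ⟨0, by rintro _ ⟨k, rfl⟩; positivity⟩⟩
  obtain ⟨p₀, hp₀⟩ := hΩ
  obtain ⟨L, hL⟩ := hdist p₀ hp₀
  have hn₁ : ∀ k, 0 ≤ (1 - 2 * b * c₁) * ‖x k - y k‖ ^ 2 := fun k => by positivity
  have hn₂ : ∀ k, 0 ≤ (1 - 2 * b * c₂) * ‖y k - z k‖ ^ 2 := fun k => by positivity
  have hn₃ : ∀ k, 0 ≤ α * (1 - α) * ‖z k - S (z k)‖ ^ 2 := fun k => by positivity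
  have hn₄ : ∀ k, 0 ≤ μ * ‖u k - A (t k)‖ ^ 2 := fun k => by positivity
  have hn₅ : ∀ k, 0 ≤ μ * (1 - μ * ‖A‖ ^ 2) * ‖T (u k) - A (t k)‖ ^ 2 := fun k => by positivity
  have hxy : Tendsto (fun k => ‖x k - y k‖) atTop (𝓝 0) :=
    SEPNM.tendsto_zero_of_mul_sq_le_sub hL hc₁ (fun k => norm_nonneg _) fun k => by
      linarith [hfejer hp₀ k, hn₂ k, hn₃ k, hn₄ k, hn₅ k]
  have hyz : Tendsto (fun k => ‖y k - z k‖) atTop (𝓝 0) :=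
    SEPNM.tendsto_zero_of_mul_sq_le_sub hL hc₂ (fun k => norm_nonneg _) fun k => by
      linarith [hfejer hp₀ k, hn₁ k, hn₃ k, hn₄ k, hn₅ k]
  have hzS : Tendsto (fun k => ‖z k - S (z k)‖) atTop (𝓝 0) :=
    SEPNM.tendsto_zero_of_mul_sq_le_sub hL hc₃ (fun k => norm_nonneg _) fun k => by
      linarith [hfejer hp₀ k, hn₁ k, hn₂ k, hn₄ k, hn₅ k]
  have huA : Tendsto (fun k => ‖u k - A (t k)‖) atTop (𝓝 0) :=
    SEPNM.tendsto_zero_of_mul_sq_le_sub hL hμ_pos (fun k => norm_nonneg _) fun k => by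
      linarith [hfejer hp₀ k, hn₁ k, hn₂ k, hn₃ k, hn₅ k]
  have hTA : Tendsto (fun k => ‖T (u k) - A (t k)‖) atTop (𝓝 0) :=
    SEPNM.tendsto_zero_of_mul_sq_le_sub hL hc₄ (fun k => norm_nonneg _) fun k => by
      linarith [hfejer hp₀ k, hn₁ k, hn₂ k, hn₃ k, hn₄ k]
  have huT : Tendsto (fun k => ‖u k - T (u k)‖) atTop (𝓝 0) :=
    squeeze_zero (fun k => norm_nonneg _)
      (fun k => (norm_sub_le_norm_sub_add_norm_sub _ (A (t k)) _).trans_eq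
        (by rw [norm_sub_rev (A (t k))])) (by simpa using huA.add hTA)
  have hzt : Tendsto (fun k => ‖z k - t k‖) atTop (𝓝 0) := by
    have h := hzS.const_mul α
    rw [mul_zero] at h
    refine h.congr fun k => ?_
    have : z k - t k = α • (z k - S (z k)) := by rw [hgen.t_step]; module
    rw [this, norm_smul, Real.norm_of_nonneg hα.1.le]
  have hAtu : Tendsto (fun k => ‖A (t k) - u k‖) atTop (𝓝 0) :=
    huA.congr fun k => norm_sub_rev _ _
  have hxM : ∀ k, ‖x k‖ ≤ ‖x 0 - p₀‖ + ‖p₀‖ := fun k => by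
    have h₁ : ‖x k - p₀‖ ≤ ‖x 0 - p₀‖ :=
      le_of_sq_le_sq (hanti p₀ hp₀ (Nat.zero_le k)) (norm_nonneg _)
    linarith [norm_le_norm_sub_add (x k) p₀]
  obtain ⟨My, hyM⟩ := SEPNM.exists_norm_le_of_tendsto_norm_sub hxM hxy
  obtain ⟨Mz, hzM⟩ := SEPNM.exists_norm_le_of_tendsto_norm_sub hyM hyz
  obtain ⟨Mt, htM⟩ := SEPNM.exists_norm_le_of_tendsto_norm_sub hzM hzt
  obtain ⟨Mu, huM⟩ := SEPNM.exists_norm_le_of_tendsto_norm_sub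
    (M := ‖A‖ * Mt)
    (fun k => (A.le_opNorm (t k)).trans (by gcongr; exact htM k)) hAtu
  have hlimits : ∀ (φ : ℕ → ℕ) (p : H₁), Tendsto φ atTop atTop →
      SEPNM.WeaklyConverges (x ∘ φ) p → SEPNM.WeaklyConverges (y ∘ φ) p ∧
        SEPNM.WeaklyConverges (z ∘ φ) p ∧ SEPNM.WeaklyConverges (u ∘ φ) (A p) := by
    intro φ p hφ h
    have hy := h.of_tendsto_norm_sub (y := y ∘ φ) (hxy.comp hφ)
    have hz := hy.of_tendsto_norm_sub (y := z ∘ φ) (hyz.comp hφ)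
    have ht := hz.of_tendsto_norm_sub (y := t ∘ φ) (hzt.comp hφ)
    exact ⟨hy, hz, (ht.map A).of_tendsto_norm_sub (y := u ∘ φ) (hAtu.comp hφ)⟩
  -- A real `δ` below the lower limit bounds `1 / r k` by `1 / δ` for all large `k`.
  obtain ⟨δ, hδ, hδr⟩ := EReal.lt_iff_exists_real_btwn.1 hr_liminf
  have hδ_pos : 0 < δ := by exact_mod_cast hδ
  have hr_ev : ∀ᶠ k in atTop, δ < r k :=
    (eventually_lt_of_lt_liminf hδr).mono fun k hk => by exact_mod_cast hk
  have hcluster : ∀ (φ : ℕ → ℕ) (p : H₁), Tendsto φ atTop atTop →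
      SEPNM.WeaklyConverges (x ∘ φ) p → p ∈ SEPNM.solutionSet C Q A f g S T := by
    intro φ p hφ h
    obtain ⟨hy, hz, hu⟩ := hlimits φ p hφ h
    have hp : p ∈ C := h.mem_of_convex hC_closed hC_convex (.of_forall fun k => hgen.mem _)
    exact ⟨⟨hgen.mem_sol hf ha.1 (fun k => (hlam k).1) hp h hy hyM (hxy.comp hφ),
      hS.mem_fix_of_weaklyConverges hC_closed hC_convex (fun k => (hgen.z_step _).1)
        (fun k => hzM _) hz (hzS.comp hφ)⟩,
      hgen.mem_sol_image hQ_closed hQ_convex hg hδ_pos (hφ.eventually hr_ev) hu huM (huA.comp hφ),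
      hT.mem_fix_of_weaklyConverges hQ_closed hQ_convex (fun k => (hgen.u_step _).1)
        (fun k => huM _) hu (huT.comp hφ)⟩
  obtain ⟨p, φ, hφ, hφp⟩ := SEPNM.exists_weaklyConverges_subseq hxM
  have hp := hcluster φ p hφ.tendsto_atTop hφp
  obtain ⟨Lp, hLp⟩ := hdist p hp
  have hx : SEPNM.WeaklyConverges x p := by
    -- Every subsequence has a further one converging weakly to some solution `q`, and Opial's
    -- argument identifies `q` with `p`.
    refine tendsto_of_subseq_tendsto fun ψ hψ => ?_
    obtain ⟨q, χ, hχ, hχq⟩ := SEPNM.exists_weaklyConverges_subseq (x := x ∘ ψ) fun k => hxM _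
    have hψχ := hψ.comp hχ.tendsto_atTop
    obtain ⟨Lq, hLq⟩ := hdist q (hcluster (ψ ∘ χ) q hψχ hχq)
    have hpq := SEPNM.eq_of_weaklyConverges_subseq hφ.tendsto_atTop hψχ hφp hχq hLp hLq
    subst hpq
    exact ⟨χ, hχq⟩
  obtain ⟨-, hz, hu⟩ := hlimits id p tendsto_id hx
  exact ⟨p, hp, hx, hz, hu, hp.2⟩
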